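/- Let $d\ge 0$ be an integer and let $T^d_\infty$ be the graph on $\mathbb{Z}^d$ in which two points are adjacent when they differ by exactly $1$ in one coordinate and agree in all the others; let $T^d_n=(C_n)^d$ be the toroidal grid graph, with vertex set $(\mathbb{Z}/n\mathbb{Z})^d$. A *$d$-dimensional figure* is a finite set of vertices of $T^d_\infty$, up to translation by integer vectors. It is connected if it induces a connected subgraph of $T^d_\infty$, and its edges are the edges of that induced subgraph. A placement of a figure on $T^d_n$ is the image, under reduction modulo $n$, of a representative of the figure, where it is required that any two points of the figure differ by less than $n$ in each coordinate. Two placed figures overlap if they share a vertex. Let $S$ be a (possibly infinite) set of connected $d$-dimensional figures, each with at least one edge. For $k\ge 0$ and $n\ge 1$ let $p_k(n^d)$ be the number of ways to place on $T^d_n$ some finite collection of pairwise non-overlapping figures from $S$ (the same figure may be used repeatedly, copies being indistinguishable) that have a total of $k$ edges. Then there are polynomials $P_0,P_1,P_2,\dots\in\mathbb{Q}[x]$ such that: 1. for each $k$ there is an $n_0$ such that for all $n\ge n_0$ the number $p_k(n^d)$ is finite and equal to $P_k(n^d)$; 2. the sequence $(P_k)_{k\ge0}$ is of binomial type, that is,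 $P_0=1$, $P_i(0)=0$ for all $i>0$, and for every integer $N\ge 0$ $$\left(\sum_{i=0}^{\infty}P_i(1)x^i\right)^N=\sum_{i=0}^{\infty}P_i(N)x^i .$$ -/

import Mathlib

open Polynomial

/-- The infinite grid graph `(C_∞)^d` on `ℤ^d`: two points are adjacent when they differ by
exactly one in one coordinate and agree in all the others. -/
def gridGraph (d : ℕ) : SimpleGraph (Fin d → ℤ) where
  Adj x y := ∃ i, |x i - y i| = 1 ∧ ∀ j, j ≠ i → x j = y j
  symm := ⟨by
    rintro x y ⟨i, hi, h⟩
    exact ⟨i, by rw [abs_sub_comm]; exact hi, fun j hj => (h j hj).symm⟩⟩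
  loopless := ⟨by
    rintro x ⟨i, hi, -⟩
    simp at hi⟩

/-- The translate of a finite set of grid points by an integer vector. -/
def translateSet {d : ℕ} (v : Fin d → ℤ) (A : Finset (Fin d → ℤ)) : Finset (Fin d → ℤ) :=
  A.image fun x => v + x

theorem mem_translateSet {d : ℕ} (v : Fin d → ℤ) (A : Finset (Fin d → ℤ)) (x : Fin d → ℤ) :
    v + x ∈ translateSet v A ↔ x ∈ A := by
  simp [translateSet]

/-- Two finite sets of grid points are equivalent when one is a translate of the other. -/
def translationSetoid (d : ℕ) : Setoid (Finset (Fin d → ℤ)) where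
  r A B := ∃ v : Fin d → ℤ, translateSet v A = B
  iseqv :=
    { refl := fun A => ⟨0, by simp [translateSet]⟩
      symm := by
        rintro A _ ⟨v, rfl⟩
        exact ⟨-v, by simp only [translateSet, Finset.image_image, Function.comp_def, neg_add_cancel_left,
          Finset.image_id']⟩
      trans := by
        rintro A _ _ ⟨v, rfl⟩ ⟨w, rfl⟩
        exact ⟨w + v, by simp only [translateSet, Finset.image_image, Function.comp_def, add_assoc]⟩ }

/-- A `d`-dimensional figure: a finite set of vertices of the infinite grid, up to translation. -/
def Figure (d : ℕ) : Type := Quotient (translationSetoid d)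

/-- The figure represented by a finite set of grid points. -/
def Figure.mk {d : ℕ} (A : Finset (Fin d → ℤ)) : Figure d := Quotient.mk (translationSetoid d) A

/-- The subgraph of the infinite grid induced on a finite set of vertices. -/
def inducedGrid {d : ℕ} (A : Finset (Fin d → ℤ)) : SimpleGraph {x // x ∈ A} :=
  (gridGraph d).comap Subtype.val

/-- Translation is an isomorphism of induced subgraphs of the grid. -/
def inducedGridIso {d : ℕ} (v : Fin d → ℤ) (A : Finset (Fin d → ℤ)) :
    inducedGrid A ≃g inducedGrid (translateSet v A) where
  toEquiv := (Equiv.addLeft v).subtypeEquiv fun x => (mem_translateSet v A x).symm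
  map_rel_iff' := by
    intro x y
    have h : ∀ z : {x // x ∈ A}, (((Equiv.addLeft v).subtypeEquiv
      fun x => (mem_translateSet v A x).symm) z : Fin d → ℤ) = v + z := fun _ => rfl
    simp [inducedGrid, gridGraph, h]

/-- A figure is connected when the subgraph of the grid induced on it is connected
(in particular nonempty). -/
def Figure.Connected {d : ℕ} (f : Figure d) : Prop :=
  Quotient.lift (s := translationSetoid d) (fun A => (inducedGrid A).Connected)
    (by rintro A _ ⟨v, rfl⟩; exact propext (inducedGridIso v A).connected_iff) f

/-- The number of edges of a figure: the number of edges of the grid joining two of its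
vertices. -/
noncomputable def Figure.numEdges {d : ℕ} (f : Figure d) : ℕ :=
  Quotient.lift (s := translationSetoid d) (fun A => Nat.card (inducedGrid A).edgeSet)
    (by rintro A _ ⟨v, rfl⟩; exact Nat.card_congr (inducedGridIso v A).mapEdgeSet) f

/-- Reduction of a grid point modulo `n`: the projection of `ℤ^d` onto the vertex set
`(ℤ/nℤ)^d` of the torus `(C_n)^d`. -/
def toTorus {d : ℕ} (n : ℕ) (x : Fin d → ℤ) : Fin d → ZMod n := fun i => (x i : ZMod n)

/-- `B` is the set of vertices occupied by some placement of the figure `f` on the torus of side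
`n`: it is the image of a representative of `f`, all of whose coordinate differences are less
than `n` (a figure whose girth is at least `n` cannot be placed). -/
def Figure.IsPlacement {d : ℕ} (f : Figure d) (n : ℕ) (B : Finset (Fin d → ZMod n)) : Prop :=
  ∃ A : Finset (Fin d → ℤ), Figure.mk A = f ∧
    (∀ x ∈ A, ∀ y ∈ A, ∀ i, |x i - y i| < (n : ℤ)) ∧ A.image (toTorus n) = B

/-- The placements on the torus of side `n` of collections of pairwise non-overlapping figures
from `S` with `k` edges in total. A figure placed on the torus is recorded as the figure together
with the set of vertices that it occupies. The same figure may occur at several positions; as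
nonempty figures at the same position overlap, a collection is a set of placed figures. -/
def placements {d : ℕ} (S : Set (Figure d)) (n k : ℕ) :
    Set (Finset (Figure d × Finset (Fin d → ZMod n))) :=
  {c | (∀ p ∈ c, p.1 ∈ S ∧ p.1.IsPlacement n p.2) ∧
    (∀ p ∈ c, ∀ q ∈ c, p ≠ q → Disjoint p.2 q.2) ∧
    ∑ p ∈ c, p.1.numEdges = k}

/-- A sequence of polynomials is of binomial type (in the normalization without binomial
coefficients). -/
structure IsBinomialType (P : ℕ → ℚ[X]) : Prop where
  zero : P 0 = 1
  eval_zero : ∀ i, 0 < i → (P i).eval 0 = 0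
  pow_eq : ∀ N : ℕ, (PowerSeries.mk fun i => (P i).eval 1) ^ N =
    PowerSeries.mk fun i => (P i).eval (N : ℚ)

/-! Let `F` be the generating function by edges of the placements on the torus of side `n`, and
`F_W` that of the placements avoiding a vertex set `W`. Marking an edge of a collection, and with it
the figure containing that edge, gives `x F' = ∑ e(p) x^e(p) F_p` over all placed figures `p`.
Sharing each term equally among the vertices of `p` and using translation invariance, this becomes
`n ^ d` times a sum over the placed figures through the origin.

The crux is that `F_W / F`, up to any fixed order in `x`, does not depend on `n` once `n` is large,
when `W` is the image of a fixed finite subset of the grid (`exists_placementSeries_image_congr`).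
Deleting one vertex at a time expresses `F_W` through series multiplied by positive powers of `x`,
and only finitely many figures with a bounded number of edges pass through a vertex.

Hence `x F' = n ^ d L F` up to any order, with `L` independent of `n`. So `F` agrees to that order
with `exp (n ^ d ∫ L / x)`, whose coefficients are polynomials in `n ^ d` of binomial type
(`exists_isBinomialType_of_eventually_euler`). -/

/-! ### Generating functions of packings by weighted pieces -/

section Packings

variable {α V : Type*} [DecidableEq α] [DecidableEq V]

/-- The sets of pieces from `Q` whose supports are pairwise disjoint and disjoint from `W`. -/
def packings (Q : Finset α) (s : α → Finset V) (W : Finset V) : Finset (Finset α) :=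
  Q.powerset.filter fun c => (∀ p ∈ c, ∀ q ∈ c, p ≠ q → Disjoint (s p) (s q)) ∧
    ∀ p ∈ c, Disjoint (s p) W

/-- The generating function of the packings that avoid `W`, by total weight. -/
noncomputable def packingSeries (Q : Finset α) (s : α → Finset V) (e : α → ℕ) (W : Finset V) :
    PowerSeries ℚ :=
  ∑ c ∈ packings Q s W, PowerSeries.X ^ ∑ p ∈ c, e p

variable {Q : Finset α} {s : α → Finset V} {e : α → ℕ}

theorem mem_packings {W : Finset V} {c : Finset α} :
    c ∈ packings Q s W ↔ c ⊆ Q ∧ (∀ p ∈ c, ∀ q ∈ c, p ≠ q → Disjoint (s p) (s q)) ∧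
      ∀ p ∈ c, Disjoint (s p) W := by
  simp [packings]

/-- Erasing `p` is the bijection. Nonemptiness of `s p` ensures that a packing avoiding `s p` cannot
already contain `p`. -/
theorem sum_packings_mem {W : Finset V} {p : α} (hp : p ∈ Q) (hs : (s p).Nonempty)
    (hW : Disjoint (s p) W) :
    ∑ c ∈ (packings Q s W).filter (p ∈ ·), (PowerSeries.X : PowerSeries ℚ) ^ ∑ q ∈ c, e q =
      PowerSeries.X ^ e p * packingSeries Q s e (W ∪ s p) := by
  rw [packingSeries, Finset.mul_sum]
  have hnot : ∀ c ∈ packings Q s (W ∪ s p), p ∉ c := by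
    intro c hc hpc
    have h := (mem_packings.1 hc).2.2 p hpc
    rw [Finset.disjoint_union_right] at h
    exact hs.ne_empty (disjoint_self.1 h.2)
  refine Finset.sum_nbij' (fun c => c.erase p) (fun c => insert p c) ?_ ?_ ?_ ?_ ?_
  · intro c hc
    rw [Finset.mem_filter, mem_packings] at hc
    obtain ⟨⟨h1, h2, h3⟩, h4⟩ := hc
    refine mem_packings.2 ⟨(Finset.erase_subset _ _).trans h1, fun a ha b hb =>
      h2 a (Finset.mem_of_mem_erase ha) b (Finset.mem_of_mem_erase hb), fun a ha => ?_⟩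
    rw [Finset.mem_erase] at ha
    exact Finset.disjoint_union_right.2 ⟨h3 a ha.2, h2 a ha.2 p h4 ha.1⟩
  · intro c hc
    obtain ⟨h1, h2, h3⟩ := mem_packings.1 hc
    simp only [Finset.disjoint_union_right] at h3
    rw [Finset.mem_filter, mem_packings]
    refine ⟨⟨Finset.insert_subset hp h1, ?_, ?_⟩, Finset.mem_insert_self _ _⟩
    · intro a ha b hb hab
      rw [Finset.mem_insert] at ha hb
      rcases ha with rfl | ha <;> rcases hb with rfl | hb
      · exact absurd rfl hab
      · exact (h3 b hb).2.symm
      · exact (h3 a ha).2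
      · exact h2 a ha b hb hab
    · intro a ha
      rw [Finset.mem_insert] at ha
      rcases ha with rfl | ha
      · exact hW
      · exact (h3 a ha).1
  · intro c hc
    exact Finset.insert_erase (Finset.mem_filter.1 hc).2
  · intro c hc
    exact Finset.erase_insert (hnot c hc)
  · intro c hc
    rw [← pow_add, Finset.add_sum_erase _ _ (Finset.mem_filter.1 hc).2]

/-- A packing either leaves `v` uncovered or covers it by exactly one piece, by disjointness; in the
second case that piece is split off. -/
theorem packingSeries_eq_insert_add (W : Finset V) (v : V) :
    packingSeries Q s e W = packingSeries Q s e (insert v W) +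
      ∑ p ∈ Q.filter (fun p => v ∈ s p ∧ Disjoint (s p) W),
        PowerSeries.X ^ e p * packingSeries Q s e (W ∪ s p) := by
  have h1 : ∑ p ∈ Q.filter (fun p => v ∈ s p ∧ Disjoint (s p) W),
      PowerSeries.X ^ e p * packingSeries Q s e (W ∪ s p) =
      ∑ c ∈ (packings Q s W).filter (fun c => ∃ p ∈ c, v ∈ s p),
        (PowerSeries.X : PowerSeries ℚ) ^ ∑ q ∈ c, e q := by
    rw [Finset.sum_congr rfl fun p hp => (sum_packings_mem (e := e) (Finset.mem_filter.1 hp).1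
      ⟨v, (Finset.mem_filter.1 hp).2.1⟩ (Finset.mem_filter.1 hp).2.2).symm]
    rw [← Finset.sum_biUnion]
    · refine Finset.sum_congr ?_ fun _ _ => rfl
      ext c
      simp only [Finset.mem_biUnion, Finset.mem_filter]
      constructor
      · rintro ⟨p, hp, hc, hpc⟩
        exact ⟨hc, p, hpc, hp.2.1⟩
      · rintro ⟨hc, p, hpc, hv⟩
        have := mem_packings.1 hc
        exact ⟨p, ⟨this.1 hpc, hv, this.2.2 p hpc⟩, hc, hpc⟩
    · intro p hp q hq hpq
      rw [Finset.mem_coe, Finset.mem_filter] at hp hq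
      refine Finset.disjoint_left.2 fun c hc hc' => ?_
      rw [Finset.mem_filter] at hc hc'
      exact Finset.disjoint_left.1 ((mem_packings.1 hc.1).2.1 p hc.2 q hc'.2 hpq) hp.2.1 hq.2.1
  have h2 : packings Q s (insert v W) =
      (packings Q s W).filter (fun c => ¬ ∃ p ∈ c, v ∈ s p) := by
    ext c
    simp only [mem_packings, Finset.mem_filter, Finset.disjoint_insert_right]
    push Not
    constructor
    · rintro ⟨h1, h2, h3⟩
      exact ⟨⟨h1, h2, fun p hp => (h3 p hp).2⟩, fun p hp => (h3 p hp).1⟩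
    · rintro ⟨⟨h1, h2, h3⟩, h4⟩
      exact ⟨h1, h2, fun p hp => ⟨h4 p hp, h3 p hp⟩⟩
  rw [h1, packingSeries, packingSeries, h2, add_comm, Finset.sum_filter_add_sum_filter_not]

/-- The Euler operator multiplies the monomial of a packing by its total weight, a sum over its
pieces; exchanging the two sums leaves, for each piece, the packings containing it. -/
theorem X_mul_derivative_packingSeries (hs : ∀ p ∈ Q, (s p).Nonempty) :
    PowerSeries.X * PowerSeries.derivative ℚ (packingSeries Q s e ∅) =
      ∑ p ∈ Q, PowerSeries.C (e p : ℚ) *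
        (PowerSeries.X ^ e p * packingSeries Q s e (s p)) := by
  have h1 : ∀ p ∈ Q, PowerSeries.C (e p : ℚ) * (PowerSeries.X ^ e p * packingSeries Q s e (s p)) =
      ∑ c ∈ packings Q s ∅, if p ∈ c then PowerSeries.C (e p : ℚ) *
        (PowerSeries.X : PowerSeries ℚ) ^ ∑ q ∈ c, e q else 0 := by
    intro p hp
    have := sum_packings_mem (e := e) hp (hs p hp) (Finset.disjoint_empty_right _)
    rw [Finset.empty_union] at this
    rw [← this, Finset.mul_sum, Finset.sum_filter]
  have hX : ∀ k : ℕ, PowerSeries.X * PowerSeries.derivative ℚ (PowerSeries.X ^ k) =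
      PowerSeries.C (k : ℚ) * (PowerSeries.X : PowerSeries ℚ) ^ k := by
    intro k
    rw [Derivation.leibniz_pow]
    cases k with
    | zero => simp
    | succ k => simp [PowerSeries.derivative_X, pow_succ]; ring
  rw [Finset.sum_congr rfl h1, Finset.sum_comm, packingSeries, map_sum, Finset.mul_sum]
  refine Finset.sum_congr rfl fun c hc => ?_
  rw [hX, ← Finset.sum_filter, Finset.filter_mem_eq_inter,
    Finset.inter_eq_right.2 (mem_packings.1 hc).1, ← Finset.sum_mul, Nat.cast_sum, map_sum]

theorem packingSeries_image (g : V ≃ V) (σ : α ≃ α) (hσ : ∀ p, σ p ∈ Q ↔ p ∈ Q)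
    (hs : ∀ p, s (σ p) = (s p).image g) (he : ∀ p, e (σ p) = e p) (W : Finset V) :
    packingSeries Q s e (W.image g) = packingSeries Q s e W := by
  symm
  refine Finset.sum_equiv σ.finsetCongr (fun c => ?_) fun c _ => ?_
  · simp only [mem_packings, Equiv.finsetCongr_apply, Finset.forall_mem_map, Finset.subset_iff,
      Equiv.coe_toEmbedding, hσ, hs, Finset.disjoint_image g.injective, ne_eq,
      EmbeddingLike.apply_eq_iff_eq]
  · simp [he]

end Packings

/-! ### The equation `X F' = M F` and sequences of binomial type -/

section EulerEquation

theorem coeff_X_mul_derivative (F : PowerSeries ℚ) (k : ℕ) :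
    PowerSeries.coeff k (PowerSeries.X * PowerSeries.derivative ℚ F) =
      k * PowerSeries.coeff k F := by
  cases k with
  | zero => simp
  | succ k => rw [PowerSeries.coeff_succ_X_mul, PowerSeries.coeff_derivative]; push_cast; ring

/-- A power series is determined by its constant coefficient and its logarithmic derivative. -/
theorem coeff_eq_of_X_pow_dvd_euler {K : ℕ} {M F G : PowerSeries ℚ}
    (hM : PowerSeries.constantCoeff M = 0)
    (h0 : PowerSeries.constantCoeff F = PowerSeries.constantCoeff G)
    (hF : PowerSeries.X ^ K ∣ PowerSeries.X * PowerSeries.derivative ℚ F - M * F)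
    (hG : PowerSeries.X ^ K ∣ PowerSeries.X * PowerSeries.derivative ℚ G - M * G) :
    ∀ k < K, PowerSeries.coeff k F = PowerSeries.coeff k G := by
  intro k
  induction k using Nat.strong_induction_on with
  | _ k ih =>
    intro hk
    rcases Nat.eq_zero_or_pos k with rfl | hpos
    · simpa using h0
    have key : ∀ {H : PowerSeries ℚ},
        PowerSeries.X ^ K ∣ PowerSeries.X * PowerSeries.derivative ℚ H - M * H →
        k * PowerSeries.coeff k H =
          ∑ p ∈ Finset.HasAntidiagonal.antidiagonal k, PowerSeries.coeff p.1 M * PowerSeries.coeff p.2 H := by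
      intro H hH
      have := PowerSeries.X_pow_dvd_iff.1 hH k hk
      rwa [map_sub, coeff_X_mul_derivative, PowerSeries.coeff_mul, sub_eq_zero] at this
    have hk' : (k : ℚ) ≠ 0 := by positivity
    apply mul_left_cancel₀ hk'
    rw [key hF, key hG]
    refine Finset.sum_congr rfl fun p hp => ?_
    rw [Finset.HasAntidiagonal.mem_antidiagonal] at hp
    rcases Nat.eq_zero_or_pos p.1 with h | h
    · rw [h, PowerSeries.coeff_zero_eq_constantCoeff_apply, hM, zero_mul, zero_mul]
    · rw [ih p.2 (by omega) (by omega)]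

/-- The coefficients of `exp (x * ∫ L / t)`, as polynomials in `x`. -/
noncomputable def eulerPolynomial (L : PowerSeries ℚ) : ℕ → ℚ[X]
  | 0 => 1
  | k + 1 => C ((k + 1 : ℚ)⁻¹) * X *
      ∑ j : Fin (k + 1), C (PowerSeries.coeff (k + 1 - j) L) * eulerPolynomial L j

theorem constantCoeff_mk_eulerPolynomial (L : PowerSeries ℚ) (y : ℚ) :
    PowerSeries.constantCoeff (PowerSeries.mk fun k => (eulerPolynomial L k).eval y) = 1 := by
  rw [← PowerSeries.coeff_zero_eq_constantCoeff_apply, PowerSeries.coeff_mk, eulerPolynomial,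
    eval_one]

/-- The recursion defining `eulerPolynomial` is this equation read coefficient by coefficient; the
vanishing constant term of `L` removes the term in which the polynomial of index `k` would occur on
both sides. -/
theorem X_mul_derivative_eulerPolynomial {L : PowerSeries ℚ}
    (hL : PowerSeries.constantCoeff L = 0) (y : ℚ) :
    PowerSeries.X * PowerSeries.derivative ℚ
        (PowerSeries.mk fun k => (eulerPolynomial L k).eval y) =
      PowerSeries.C y * L * PowerSeries.mk fun k => (eulerPolynomial L k).eval y := by
  ext k
  rw [coeff_X_mul_derivative, mul_assoc, PowerSeries.coeff_C_mul, mul_comm L, PowerSeries.coeff_mul,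
    Finset.Nat.sum_antidiagonal_eq_sum_range_succ
      (fun i j => PowerSeries.coeff i (PowerSeries.mk fun k => (eulerPolynomial L k).eval y) *
        PowerSeries.coeff j L), Finset.sum_range_succ, Nat.sub_self,
      PowerSeries.coeff_zero_eq_constantCoeff_apply (φ := L), hL, mul_zero, add_zero,
      PowerSeries.coeff_mk]
  cases k with
  | zero => simp
  | succ k =>
    rw [eulerPolynomial, eval_mul, eval_mul, eval_C, eval_X, eval_finsetSum,
      Fin.sum_univ_eq_sum_range
        (fun j => (C (PowerSeries.coeff (k + 1 - j) L) * eulerPolynomial L j).eval y)]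
    have hk : (k + 1 : ℚ) ≠ 0 := by positivity
    push_cast
    rw [← mul_assoc, ← mul_assoc, mul_inv_cancel₀ hk, one_mul]
    simp [mul_comm]

/-- The `N`-th power of the series at `1` and the series at `N` solve the same Euler equation, with
factor `N L`, and both have constant coefficient 1. -/
theorem isBinomialType_eulerPolynomial {L : PowerSeries ℚ}
    (hL : PowerSeries.constantCoeff L = 0) : IsBinomialType (eulerPolynomial L) where
  zero := by rw [eulerPolynomial]
  eval_zero i hi := by
    obtain ⟨k, rfl⟩ := Nat.exists_eq_succ_of_ne_zero hi.ne'
    simp [eulerPolynomial]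
  pow_eq N := by
    ext k
    refine coeff_eq_of_X_pow_dvd_euler (K := k + 1) (M := PowerSeries.C (N : ℚ) * L) ?_ ?_ ?_ ?_ k
      k.lt_succ_self
    · simp [hL]
    · rw [map_pow, constantCoeff_mk_eulerPolynomial, constantCoeff_mk_eulerPolynomial, one_pow]
    · have h := X_mul_derivative_eulerPolynomial hL 1
      rw [map_one, one_mul] at h
      rw [PowerSeries.derivative_pow]
      convert dvd_zero _
      -- The power rule involves the truncated exponent `N - 1`, so `N = 0` is separate.
      cases N with
      | zero => simp
      | succ N =>
        rw [Nat.add_sub_cancel, map_natCast]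
        linear_combination ((N + 1 : ℕ) : PowerSeries ℚ) *
          (PowerSeries.mk fun i => (eulerPolynomial L i).eval 1) ^ N * h
    · rw [X_mul_derivative_eulerPolynomial hL, sub_self]
      exact dvd_zero _

/-- Series whose logarithmic derivatives are eventually proportional to `a n`, up to any order,
have coefficients that are eventually polynomials in `a n` forming a sequence of binomial type. -/
theorem exists_isBinomialType_of_eventually_euler {F : ℕ → PowerSeries ℚ} {a : ℕ → ℚ}
    (hF : ∀ᶠ n in Filter.atTop, PowerSeries.constantCoeff (F n) = 1)
    (ha : ∀ᶠ n in Filter.atTop, a n ≠ 0)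
    (h : ∀ K : ℕ, ∃ L : PowerSeries ℚ, ∀ᶠ n in Filter.atTop, PowerSeries.X ^ K ∣
      PowerSeries.X * PowerSeries.derivative ℚ (F n) - PowerSeries.C (a n) * L * F n) :
    ∃ P : ℕ → ℚ[X], IsBinomialType P ∧ ∀ k : ℕ, ∀ᶠ n in Filter.atTop,
      PowerSeries.coeff k (F n) = (P k).eval (a n) := by
  choose L hL using h
  -- A single large `n` suffices: `a n * F n` is then a unit, so the congruence determines `L K`
  -- modulo `X ^ K`. The series `L K` are therefore compatible and have a common limit.
  have huniq : ∀ K K', K ≤ K' → PowerSeries.X ^ K ∣ L K - L K' := by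
    intro K K' hKK
    obtain ⟨n, h1, h2, h3, h4⟩ := (hF.and (ha.and ((hL K).and (hL K')))).exists
    have hu : IsUnit (PowerSeries.C (a n) * F n) := by
      rw [PowerSeries.isUnit_iff_constantCoeff]
      simp [h1, h2]
    rw [← hu.dvd_mul_right]
    have := dvd_sub ((pow_dvd_pow _ hKK).trans h4) h3
    convert this using 1
    ring
  set M : PowerSeries ℚ := PowerSeries.mk fun j => PowerSeries.coeff j (L (j + 1)) with hM
  have hML : ∀ K, PowerSeries.X ^ K ∣ M - L K := by
    intro K
    rw [PowerSeries.X_pow_dvd_iff]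
    intro j hj
    rw [map_sub, hM, PowerSeries.coeff_mk, ← map_sub]
    exact PowerSeries.X_pow_dvd_iff.1 (huniq (j + 1) K hj) j j.lt_succ_self
  have hMF : ∀ K, ∀ᶠ n in Filter.atTop, PowerSeries.X ^ K ∣
      PowerSeries.X * PowerSeries.derivative ℚ (F n) - PowerSeries.C (a n) * M * F n := by
    intro K
    filter_upwards [hL K] with n hn
    have := dvd_sub hn ((hML K).mul_left (PowerSeries.C (a n) * F n))
    convert this using 1
    ring
  have hM0 : PowerSeries.constantCoeff M = 0 := by
    obtain ⟨n, h1, h2, h3⟩ := (hF.and (ha.and (hMF 1))).exists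
    rw [pow_one, PowerSeries.X_dvd_iff] at h3
    simpa [h1, h2] using h3
  refine ⟨eulerPolynomial M, isBinomialType_eulerPolynomial hM0, fun k => ?_⟩
  filter_upwards [hF, hMF (k + 1)] with n h1 h2
  have := coeff_eq_of_X_pow_dvd_euler (M := PowerSeries.C (a n) * M)
    (G := PowerSeries.mk fun k => (eulerPolynomial M k).eval (a n)) (by simp [hM0])
    (by rw [h1, constantCoeff_mk_eulerPolynomial]) h2
    (by rw [X_mul_derivative_eulerPolynomial hM0, sub_self]; exact dvd_zero _) k k.lt_succ_self
  rw [this, PowerSeries.coeff_mk]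

end EulerEquation

/-! ### Figures in the grid and their placements on the torus -/

section Geometry

variable {d : ℕ}

theorem inducedGrid.abs_sub_le_length {A : Finset (Fin d → ℤ)} {x y : {x // x ∈ A}}
    (w : (inducedGrid A).Walk x y) (i : Fin d) : |x.1 i - y.1 i| ≤ w.length := by
  induction w with
  | nil => simp
  | @cons u v w h p ih =>
    have h' : (gridGraph d).Adj u.1 v.1 := h
    obtain ⟨j, hj, hne⟩ := h'
    have h1 : |u.1 i - v.1 i| ≤ 1 := by
      by_cases hij : i = j
      · rw [hij, hj]
      · simp [hne i hij]
    have h2 : ((SimpleGraph.Walk.cons h p).length : ℤ) = p.length + 1 := by simp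
    have := abs_sub_le (u.1 i) (v.1 i) (w.1 i)
    exact this.trans (by rw [h2]; lia)

/-- A path uses each edge at most once and each edge changes a coordinate by at most one. This bound
makes the figures with at most `K` edges through a point finite in number, even for infinite `S`,
and makes them fit on every torus with `n > K`. -/
theorem Figure.abs_sub_le_numEdges {A : Finset (Fin d → ℤ)} (hA : (Figure.mk A).Connected)
    {x y : Fin d → ℤ} (hx : x ∈ A) (hy : y ∈ A) (i : Fin d) :
    |x i - y i| ≤ (Figure.mk A).numEdges := by
  classical
  have hc : (inducedGrid A).Connected := hA
  obtain ⟨p, hp⟩ := (hc.preconnected ⟨x, hx⟩ ⟨y, hy⟩).exists_isPath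
  refine (inducedGrid.abs_sub_le_length p i).trans ?_
  have : Fintype (inducedGrid A).edgeSet := Fintype.ofFinite _
  have h := hp.isTrail.length_le_card_edgeFinset
  have h2 : (Figure.mk A).numEdges = (inducedGrid A).edgeFinset.card := by
    rw [SimpleGraph.edgeFinset_card, ← Nat.card_eq_fintype_card]; rfl
  rw [h2]
  exact_mod_cast h

theorem Figure.mk_translateSet (v : Fin d → ℤ) (A : Finset (Fin d → ℤ)) :
    Figure.mk (translateSet v A) = Figure.mk A :=
  (Quotient.sound (s := translationSetoid d) ⟨v, rfl⟩ : Figure.mk A = _).symm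

theorem Figure.nonempty_of_connected {A : Finset (Fin d → ℤ)} (hA : (Figure.mk A).Connected) :
    A.Nonempty := by
  have hc : (inducedGrid A).Connected := hA
  obtain ⟨x⟩ := hc.nonempty
  exact ⟨x.1, x.2⟩

theorem toTorus_add (n : ℕ) (x y : Fin d → ℤ) :
    toTorus n (x + y) = toTorus n x + toTorus n y := by
  ext i; simp [toTorus]

theorem toTorus_zero (n : ℕ) : toTorus n (0 : Fin d → ℤ) = 0 := by
  ext i; simp [toTorus]

theorem toTorus_surjective (n : ℕ) : Function.Surjective (toTorus (d := d) n) := by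
  intro t
  choose x hx using fun i => ZMod.intCast_surjective (t i)
  exact ⟨x, funext hx⟩

theorem image_toTorus_translateSet (n : ℕ) (v : Fin d → ℤ) (A : Finset (Fin d → ℤ)) :
    (translateSet v A).image (toTorus n) = (A.image (toTorus n)).image (toTorus n v + ·) := by
  simp only [translateSet, Finset.image_image, Function.comp_def, toTorus_add]

theorem toTorus_eq_of_abs_sub_lt {n : ℕ} {x y : Fin d → ℤ} (h : toTorus n x = toTorus n y)
    (hlt : ∀ i, |x i - y i| < n) : x = y := by
  ext i
  have h1 : ((x i : ℤ) : ZMod n) = (y i : ℤ) := congrFun h i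
  rw [ZMod.intCast_eq_intCast_iff_dvd_sub] at h1
  have := Int.eq_zero_of_abs_lt_dvd h1 (by rw [abs_sub_comm]; exact hlt i)
  omega

theorem card_image_toTorus {n : ℕ} {A : Finset (Fin d → ℤ)}
    (h : ∀ x ∈ A, ∀ y ∈ A, ∀ i, |x i - y i| < (n : ℤ)) : (A.image (toTorus n)).card = A.card :=
  Finset.card_image_of_injOn fun x hx y hy hxy => toTorus_eq_of_abs_sub_lt hxy (h x hx y hy)

theorem eventually_injOn_toTorus (Y : Finset (Fin d → ℤ)) :
    ∀ᶠ n in Filter.atTop, Set.InjOn (toTorus n) (Y : Set (Fin d → ℤ)) := by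
  have : ∀ᶠ n : ℕ in Filter.atTop, ∀ x ∈ Y, ∀ y ∈ Y, ∀ i, |x i - y i| < (n : ℤ) := by
    simp only [Filter.eventually_all_finset, Filter.eventually_all]
    intro x _ y _ i
    filter_upwards [Filter.eventually_gt_atTop (|x i - y i|).toNat] with n hn
    omega
  filter_upwards [this] with n hn x hx y hy hxy
  exact toTorus_eq_of_abs_sub_lt hxy (hn x hx y hy)

/-- The placed figures from `S` with at most `K` edges on the torus of side `n`. -/
def placedFigures (S : Set (Figure d)) (n K : ℕ) : Set (Figure d × Finset (Fin d → ZMod n)) :=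
  {p | p.1 ∈ S ∧ p.1.numEdges ≤ K ∧ p.1.IsPlacement n p.2}

/-- The finite sets of grid points through `v` representing figures from `S` with at most `K`
edges. -/
def figuresThrough (S : Set (Figure d)) (K : ℕ) (v : Fin d → ℤ) : Set (Finset (Fin d → ℤ)) :=
  {A | v ∈ A ∧ Figure.mk A ∈ S ∧ (Figure.mk A).numEdges ≤ K}

variable {S : Set (Figure d)} {K : ℕ}

theorem figuresThrough_subset (hconn : ∀ f ∈ S, f.Connected) (v : Fin d → ℤ) :
    figuresThrough S K v ⊆
      (Finset.Icc (v - fun _ => (K : ℤ)) (v + fun _ => (K : ℤ))).powerset := by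
  rintro A ⟨hv, hS, hK⟩
  rw [Finset.mem_coe, Finset.mem_powerset]
  intro x hx
  rw [Finset.mem_Icc, Pi.le_def, Pi.le_def, ← forall_and]
  intro i
  have h := Figure.abs_sub_le_numEdges (hconn _ hS) hx hv i
  rw [abs_le] at h
  simp only [Pi.sub_apply, Pi.add_apply]
  lia

theorem figuresThrough_finite (hconn : ∀ f ∈ S, f.Connected) (v : Fin d → ℤ) :
    (figuresThrough S K v).Finite :=
  (Finset.finite_toSet _).subset (figuresThrough_subset hconn v)

/-- A representative with a point `a` congruent to `v` is moved by `v - a`, which vanishes modulo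
`n`, so its image on the torus is unchanged. -/
theorem exists_mem_figuresThrough {n : ℕ} {p : Figure d × Finset (Fin d → ZMod n)}
    (hp : p ∈ placedFigures S n K) {v : Fin d → ℤ} (hv : toTorus n v ∈ p.2) :
    ∃ A ∈ figuresThrough S K v, (Figure.mk A, A.image (toTorus n)) = p := by
  obtain ⟨f, B⟩ := p
  obtain ⟨hS, hK, A, rfl, hlt, rfl⟩ := hp
  obtain ⟨a, ha, hav⟩ := Finset.mem_image.1 hv
  have hA : Figure.mk (translateSet (v - a) A) = Figure.mk A := Figure.mk_translateSet _ _
  refine ⟨translateSet (v - a) A, ⟨?_, ?_, ?_⟩, ?_⟩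
  · simpa using (mem_translateSet (v - a) A a).2 ha
  · rwa [hA]
  · rwa [hA]
  · have h0 : toTorus n (v - a) = 0 := by
      have := toTorus_add n (v - a) a
      rwa [sub_add_cancel, hav, right_eq_add] at this
    rw [hA, image_toTorus_translateSet, h0]
    simp

theorem mk_mem_placedFigures (hconn : ∀ f ∈ S, f.Connected) {n : ℕ} (hn : K < n)
    {v : Fin d → ℤ} {A : Finset (Fin d → ℤ)} (hA : A ∈ figuresThrough S K v) :
    (Figure.mk A, A.image (toTorus n)) ∈ placedFigures S n K := by
  refine ⟨hA.2.1, hA.2.2, A, rfl, fun x hx y hy i => ?_, rfl⟩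
  have := Figure.abs_sub_le_numEdges (hconn _ hA.2.1) hx hy i
  have := hA.2.2
  lia

theorem Figure.IsPlacement.nonempty {f : Figure d} {n : ℕ} {B : Finset (Fin d → ZMod n)}
    (h : f.IsPlacement n B) (hf : f.Connected) : B.Nonempty := by
  obtain ⟨A, rfl, -, rfl⟩ := h
  exact (Figure.nonempty_of_connected hf).image _

theorem placedFigures_finite (hconn : ∀ f ∈ S, f.Connected) (n : ℕ) [NeZero n] :
    (placedFigures S n K).Finite := by
  choose v hv using toTorus_surjective (d := d) n
  refine (Set.finite_iUnion fun t => (figuresThrough_finite (K := K) hconn (v t)).image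
    fun A => (Figure.mk A, A.image (toTorus n))).subset fun p hp => ?_
  obtain ⟨t, ht⟩ := hp.2.2.nonempty (hconn _ hp.1)
  rw [← hv t] at ht
  exact Set.mem_iUnion.2 ⟨t, exists_mem_figuresThrough hp ht⟩

/-- Translation of placed figures by an element of the torus. -/
def translatePlaced {n : ℕ} (t : Fin d → ZMod n) :
    Figure d × Finset (Fin d → ZMod n) ≃ Figure d × Finset (Fin d → ZMod n) :=
  Equiv.prodCongr (Equiv.refl _) (Equiv.addLeft t).finsetCongr

theorem translatePlaced_snd {n : ℕ} (t : Fin d → ZMod n)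
    (p : Figure d × Finset (Fin d → ZMod n)) :
    (translatePlaced t p).2 = p.2.image (Equiv.addLeft t) := by
  simp [translatePlaced, Finset.map_eq_image]

theorem translatePlaced_mem {n : ℕ} (t : Fin d → ZMod n)
    (p : Figure d × Finset (Fin d → ZMod n)) :
    translatePlaced t p ∈ placedFigures S n K ↔ p ∈ placedFigures S n K := by
  have key : ∀ (t : Fin d → ZMod n) (p : Figure d × Finset (Fin d → ZMod n)),
      p ∈ placedFigures S n K → translatePlaced t p ∈ placedFigures S n K := by
    rintro t ⟨f, B⟩ ⟨hS, hK, A, rfl, hlt, rfl⟩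
    obtain ⟨v, rfl⟩ := toTorus_surjective n t
    refine ⟨hS, hK, translateSet v A, Figure.mk_translateSet v A, ?_, ?_⟩
    · simp only [translateSet, Finset.forall_mem_image, Pi.add_apply, add_sub_add_left_eq_sub]
      exact hlt
    · rw [image_toTorus_translateSet, translatePlaced_snd]
      rfl
  refine ⟨fun h => ?_, key t p⟩
  have h2 := key (-t) _ h
  convert h2 using 1
  refine Prod.ext rfl ?_
  rw [translatePlaced_snd, translatePlaced_snd, Finset.image_image]
  simp only [Function.comp_def, Equiv.coe_addLeft, neg_add_cancel_left, Finset.image_id']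

end Geometry

/-! ### Generating functions of placements on large tori -/

section Torus

noncomputable instance (d : ℕ) : DecidableEq (Figure d) := Classical.decEq _

/-- The generating function, by number of edges, of the placements avoiding `W` of
non-overlapping figures taken from `Q`. -/
noncomputable def placementSeries {d n : ℕ} (Q : Finset (Figure d × Finset (Fin d → ZMod n)))
    (W : Finset (Fin d → ZMod n)) : PowerSeries ℚ :=
  packingSeries Q Prod.snd (fun p => p.1.numEdges) W

variable {d : ℕ} {S : Set (Figure d)} {K : ℕ}

/-- This is where dependence on `n` disappears: the sum is reindexed by a set of grid figures not
involving `n`. All of them lie in the box of radius `K` around `v`, so injectivity of reduction on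
that box keeps distinct figures distinct. -/
theorem sum_placedFigures_through (hconn : ∀ f ∈ S, f.Connected) {n : ℕ} (hn : K < n)
    {Q : Finset (Figure d × Finset (Fin d → ZMod n))} (hQ : (Q : Set _) = placedFigures S n K)
    {v : Fin d → ℤ}
    (hinj : Set.InjOn (toTorus n)
      ((Finset.Icc (v - fun _ => (K : ℤ)) (v + fun _ => (K : ℤ)) : Finset (Fin d → ℤ)) :
        Set (Fin d → ℤ)))
    {M : Type*} [AddCommMonoid M] (f : Figure d × Finset (Fin d → ZMod n) → M) :
    ∑ p ∈ Q.filter (fun p => toTorus n v ∈ p.2), f p =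
      ∑ A ∈ (figuresThrough_finite (K := K) hconn v).toFinset,
        f (Figure.mk A, A.image (toTorus n)) := by
  have hmem : ∀ p, p ∈ Q ↔ p ∈ placedFigures S n K := fun p => by rw [← hQ, Finset.mem_coe]
  symm
  refine Finset.sum_nbij (fun A => (Figure.mk A, A.image (toTorus n))) ?_ ?_ ?_ fun _ _ => rfl
  · intro A hA
    rw [Set.Finite.mem_toFinset] at hA
    rw [Finset.mem_filter, hmem]
    exact ⟨mk_mem_placedFigures hconn hn hA, Finset.mem_image_of_mem _ hA.1⟩
  · intro A hA B hB hAB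
    rw [Set.Finite.coe_toFinset] at hA hB
    have h1 := Finset.mem_powerset.1 (figuresThrough_subset hconn v hA)
    have h2 := Finset.mem_powerset.1 (figuresThrough_subset hconn v hB)
    have h3 := congrArg (fun C : Finset _ => (C : Set (Fin d → ZMod n))) (Prod.ext_iff.1 hAB).2
    simp only [Finset.coe_image] at h3
    rw [hinj.image_eq_image_iff (Finset.coe_subset.2 h1) (Finset.coe_subset.2 h2)] at h3
    exact_mod_cast h3
  · intro p hp
    rw [Finset.mem_coe, Finset.mem_filter, hmem] at hp
    obtain ⟨A, hA, rfl⟩ := exists_mem_figuresThrough hp.1 hp.2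
    exact ⟨A, by rwa [Set.Finite.coe_toFinset], rfl⟩

/-- Up to any given order, the ratio of the generating functions of the placements avoiding the
image of a fixed finite set and of all placements is eventually independent of the torus. -/
theorem exists_placementSeries_image_congr (hconn : ∀ f ∈ S, f.Connected)
    (hedge : ∀ f ∈ S, 0 < f.numEdges) (k : ℕ) :
    ∀ U : Finset (Fin d → ℤ), ∃ R : PowerSeries ℚ, ∀ᶠ n in Filter.atTop,
      ∀ Q : Finset (Figure d × Finset (Fin d → ZMod n)), (Q : Set _) = placedFigures S n K →
        PowerSeries.X ^ k ∣
          placementSeries Q (U.image (toTorus n)) - R * placementSeries Q ∅ := by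
  induction k with
  | zero => exact fun U => ⟨0, by simp⟩
  | succ k ih =>
    -- The hypothesis at order `k` is kept for all finite sets, since the vertex recursion applies
    -- it to `U ∪ A`; the inner induction on `U` stays at order `k + 1`.
    choose R' hR' using ih
    intro U
    induction U using Finset.induction_on with
    | empty => exact ⟨1, by simp⟩
    | insert v U _ ihU =>
      obtain ⟨R, hR⟩ := ihU
      set T := (figuresThrough_finite (K := K) hconn v).toFinset
      have hT' : ∀ A, A ∈ T ↔ A ∈ figuresThrough S K v := fun A => Set.Finite.mem_toFinset _
      set Y : Finset (Fin d → ℤ) := Finset.Icc (v - fun _ => (K : ℤ)) (v + fun _ => (K : ℤ))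
      -- The witness is the vertex recursion at `v` with each series replaced by its ratio to the
      -- series of all placements.
      refine ⟨R - ∑ A ∈ T, if Disjoint A U then
        PowerSeries.X ^ (Figure.mk A).numEdges * R' (U ∪ A) else 0, ?_⟩
      have hall : ∀ᶠ n in Filter.atTop, ∀ A ∈ T,
          ∀ Q : Finset (Figure d × Finset (Fin d → ZMod n)), (Q : Set _) = placedFigures S n K →
            PowerSeries.X ^ k ∣ placementSeries Q ((U ∪ A).image (toTorus n)) -
              R' (U ∪ A) * placementSeries Q ∅ :=
        (Filter.eventually_all_finset T).2 fun A _ => hR' (U ∪ A)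
      -- Injectivity on the box together with `U` makes disjointness from `U` on the torus
      -- equivalent to disjointness in the grid.
      filter_upwards [hR, hall, Filter.eventually_gt_atTop K, eventually_injOn_toTorus (Y ∪ U)]
        with n h1 h2 hn hinj Q hQ
      have hY : Set.InjOn (toTorus n) (Y : Set (Fin d → ℤ)) :=
        hinj.mono (by exact_mod_cast Finset.subset_union_left)
      have hdisj : ∀ A ∈ T, (Disjoint (A.image (toTorus n)) (U.image (toTorus n)) ↔
          Disjoint A U) := by
        intro A hA
        have hAY : A ⊆ Y :=
          Finset.mem_powerset.1 (figuresThrough_subset hconn v ((hT' A).1 hA))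
        constructor
        · intro h
          rw [Finset.disjoint_left] at h ⊢
          exact fun x hx hx' => h (Finset.mem_image_of_mem _ hx) (Finset.mem_image_of_mem _ hx')
        · intro h
          simp only [Finset.disjoint_left, Finset.mem_image, not_exists, not_and,
            forall_exists_index, and_imp]
          rintro _ x hx rfl y hy hxy
          have := hinj (by simp [hy]) (by simp [hAY hx]) hxy
          exact Finset.disjoint_left.1 h hx (this ▸ hy)
      have hrec := packingSeries_eq_insert_add (Q := Q) (s := Prod.snd)
        (e := fun p => p.1.numEdges) (U.image (toTorus n)) (toTorus n v)
      rw [← Finset.filter_filter, Finset.sum_filter,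
        sum_placedFigures_through hconn hn hQ hY] at hrec
      have hrec' : placementSeries Q ((insert v U).image (toTorus n)) =
          placementSeries Q (U.image (toTorus n)) - ∑ A ∈ T, if Disjoint A U then
            PowerSeries.X ^ (Figure.mk A).numEdges *
              placementSeries Q ((U ∪ A).image (toTorus n)) else 0 := by
        rw [Finset.image_insert, placementSeries, placementSeries, hrec, eq_sub_iff_add_eq]
        congr 1
        refine Finset.sum_congr rfl fun A hA => ?_
        rw [Finset.image_union]
        exact if_congr (hdisj A hA).symm rfl rfl
      have hsplit : placementSeries Q ((insert v U).image (toTorus n)) -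
          (R - ∑ A ∈ T, if Disjoint A U then
            PowerSeries.X ^ (Figure.mk A).numEdges * R' (U ∪ A) else 0) * placementSeries Q ∅ =
          (placementSeries Q (U.image (toTorus n)) - R * placementSeries Q ∅) -
          ∑ A ∈ T, if Disjoint A U then PowerSeries.X ^ (Figure.mk A).numEdges *
            (placementSeries Q ((U ∪ A).image (toTorus n)) -
              R' (U ∪ A) * placementSeries Q ∅) else 0 := by
        rw [hrec', sub_mul, Finset.sum_mul, sub_sub_sub_comm, ← Finset.sum_sub_distrib]
        congr 1
        refine Finset.sum_congr rfl fun A _ => ?_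
        split_ifs
        · ring
        · ring
      rw [hsplit]
      refine dvd_sub (h1 Q hQ) (Finset.dvd_sum fun A hA => ?_)
      split_ifs
      -- A figure has at least one edge, so its factor `X ^ e` supplies the one order missing from
      -- the hypothesis at `k`.
      · rw [pow_succ']
        have he := hedge _ ((hT' A).1 hA).2.1
        exact mul_dvd_mul (dvd_pow_self _ he.ne') (h2 A hA Q hQ)
      · exact dvd_zero _

theorem placementSeries_translate {n : ℕ} {Q : Finset (Figure d × Finset (Fin d → ZMod n))}
    (hQ : (Q : Set _) = placedFigures S n K) (t : Fin d → ZMod n)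
    (W : Finset (Fin d → ZMod n)) :
    placementSeries Q (W.image (Equiv.addLeft t)) = placementSeries Q W := by
  have hmem : ∀ p, p ∈ Q ↔ p ∈ placedFigures S n K := fun p => by rw [← hQ, Finset.mem_coe]
  exact packingSeries_image (Equiv.addLeft t) (translatePlaced t)
    (fun p => by rw [hmem, hmem, translatePlaced_mem]) (translatePlaced_snd t) (fun _ => rfl) W

/-- The logarithmic derivative of the generating function of the placements is the number of
vertices of the torus times a sum over the placed figures through the origin. -/
theorem X_mul_derivative_placementSeries (hconn : ∀ f ∈ S, f.Connected) {n : ℕ} [NeZero n]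
    {Q : Finset (Figure d × Finset (Fin d → ZMod n))} (hQ : (Q : Set _) = placedFigures S n K) :
    PowerSeries.X * PowerSeries.derivative ℚ (placementSeries Q ∅) =
      PowerSeries.C ((n : ℚ) ^ d) * ∑ p ∈ Q.filter (fun p => 0 ∈ p.2),
        PowerSeries.C ((p.1.numEdges : ℚ) / p.2.card) *
          (PowerSeries.X ^ p.1.numEdges * placementSeries Q p.2) := by
  have hmem : ∀ p, p ∈ Q ↔ p ∈ placedFigures S n K := fun p => by rw [← hQ, Finset.mem_coe]
  have hne : ∀ p ∈ Q, p.2.Nonempty := fun p hp =>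
    ((hmem p).1 hp).2.2.nonempty (hconn _ ((hmem p).1 hp).1)
  set f : Figure d × Finset (Fin d → ZMod n) → PowerSeries ℚ := fun p =>
    PowerSeries.C ((p.1.numEdges : ℚ) / p.2.card) *
      (PowerSeries.X ^ p.1.numEdges * placementSeries Q p.2) with hf
  have h1 : ∀ t : Fin d → ZMod n, ∑ p ∈ Q.filter (fun p => t ∈ p.2), f p =
      ∑ p ∈ Q.filter (fun p => 0 ∈ p.2), f p := by
    intro t
    symm
    refine Finset.sum_equiv (translatePlaced t) (fun p => ?_) fun p _ => ?_
    · rw [Finset.mem_filter, Finset.mem_filter, hmem, hmem, translatePlaced_mem,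
        translatePlaced_snd]
      simp
    · have h : (translatePlaced t p).1 = p.1 := rfl
      simp only [hf]
      rw [h, translatePlaced_snd, placementSeries_translate hQ,
        Finset.card_image_of_injective _ (Equiv.injective _)]
  -- Each placed figure is counted once for each of its vertices, which cancels the division by
  -- `p.2.card` in `f`.
  have h2 : ∑ p ∈ Q, PowerSeries.C (p.1.numEdges : ℚ) *
      (PowerSeries.X ^ p.1.numEdges * placementSeries Q p.2) =
      ∑ t : Fin d → ZMod n, ∑ p ∈ Q.filter (fun p => t ∈ p.2), f p := by
    simp only [Finset.sum_filter]
    rw [Finset.sum_comm]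
    refine Finset.sum_congr rfl fun p hp => ?_
    have hc : (p.2.card : ℚ) ≠ 0 := by exact_mod_cast (hne p hp).card_pos.ne'
    rw [← Finset.sum_filter, Finset.filter_mem_eq_inter, Finset.univ_inter, Finset.sum_const,
      nsmul_eq_mul, ← map_natCast (PowerSeries.C (R := ℚ))]
    simp only [hf]
    rw [← mul_assoc (PowerSeries.C (p.2.card : ℚ)), ← map_mul, mul_div_cancel₀ _ hc]
  rw [placementSeries, X_mul_derivative_packingSeries hne]
  refine h2.trans ?_
  rw [Finset.sum_congr rfl fun t _ => h1 t, Finset.sum_const, nsmul_eq_mul, Finset.card_univ,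
    Fintype.card_fun, ZMod.card, Fintype.card_fin, ← map_natCast (PowerSeries.C (R := ℚ)),
    Nat.cast_pow]

theorem exists_euler_placementSeries (hconn : ∀ f ∈ S, f.Connected)
    (hedge : ∀ f ∈ S, 0 < f.numEdges) (k : ℕ) :
    ∃ L : PowerSeries ℚ, ∀ᶠ n in Filter.atTop,
      ∀ Q : Finset (Figure d × Finset (Fin d → ZMod n)), (Q : Set _) = placedFigures S n K →
        PowerSeries.X ^ k ∣ PowerSeries.X * PowerSeries.derivative ℚ (placementSeries Q ∅) -
          PowerSeries.C ((n : ℚ) ^ d) * L * placementSeries Q ∅ := by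
  choose R hR using exists_placementSeries_image_congr (K := K) hconn hedge k
  set T := (figuresThrough_finite (K := K) hconn 0).toFinset
  have hT' : ∀ A, A ∈ T ↔ A ∈ figuresThrough S K 0 := fun A => Set.Finite.mem_toFinset _
  refine ⟨∑ A ∈ T, PowerSeries.C (((Figure.mk A).numEdges : ℚ) / A.card) *
    (PowerSeries.X ^ (Figure.mk A).numEdges * R A), ?_⟩
  filter_upwards [(Filter.eventually_all_finset T).2 fun A _ => hR A,
    Filter.eventually_gt_atTop K, eventually_injOn_toTorus _] with n h1 hn hinj Q hQ
  have : NeZero n := ⟨by omega⟩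
  rw [X_mul_derivative_placementSeries hconn hQ, ← toTorus_zero,
    sum_placedFigures_through hconn hn hQ hinj, mul_assoc, ← mul_sub, Finset.sum_mul,
    ← Finset.sum_sub_distrib]
  refine (Finset.dvd_sum fun A hA => ?_).mul_left _
  have hcard : (A.image (toTorus n)).card = A.card := by
    refine card_image_toTorus fun x hx y hy i => ?_
    have hA' := (hT' A).1 hA
    have := Figure.abs_sub_le_numEdges (hconn _ hA'.2.1) hx hy i
    have := hA'.2.2
    lia
  dsimp only
  rw [hcard, mul_assoc, ← mul_sub, mul_assoc, ← mul_sub]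
  exact ((h1 A hA Q hQ).mul_left _).mul_left _

/-- The cutoff `K` loses nothing: a figure in a collection with `k` edges in total has at most `k`
edges itself. -/
theorem mem_placements_iff {n k : ℕ} (hk : k ≤ K)
    {Q : Finset (Figure d × Finset (Fin d → ZMod n))} (hQ : (Q : Set _) = placedFigures S n K)
    {c : Finset (Figure d × Finset (Fin d → ZMod n))} :
    c ∈ placements S n k ↔ c ∈ packings Q Prod.snd ∅ ∧ ∑ p ∈ c, p.1.numEdges = k := by
  have hmem : ∀ p, p ∈ Q ↔ p ∈ placedFigures S n K := fun p => by rw [← hQ, Finset.mem_coe]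
  rw [mem_packings]
  constructor
  · rintro ⟨h1, h2, h3⟩
    refine ⟨⟨fun p hp => (hmem p).2 ⟨(h1 p hp).1, ?_, (h1 p hp).2⟩, h2, by simp⟩, h3⟩
    exact (Finset.single_le_sum (f := fun p : Figure d × Finset (Fin d → ZMod n) =>
      p.1.numEdges) (fun _ _ => Nat.zero_le _) hp).trans (h3.le.trans hk)
  · rintro ⟨⟨h1, h2, -⟩, h3⟩
    exact ⟨fun p hp => ⟨((hmem p).1 (h1 hp)).1, ((hmem p).1 (h1 hp)).2.2⟩, h2, h3⟩

theorem coe_filter_packings_eq_placements {n k : ℕ} (hk : k ≤ K)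
    {Q : Finset (Figure d × Finset (Fin d → ZMod n))}
    (hQ : (Q : Set _) = placedFigures S n K) :
    (((packings Q Prod.snd ∅).filter fun c => k = ∑ p ∈ c, p.1.numEdges : Finset _) : Set _) =
      placements S n k := by
  ext c
  rw [mem_placements_iff hk hQ, Finset.mem_coe, Finset.mem_filter, eq_comm (a := k)]

theorem coeff_placementSeries {n k : ℕ} (hk : k ≤ K)
    {Q : Finset (Figure d × Finset (Fin d → ZMod n))}
    (hQ : (Q : Set _) = placedFigures S n K) :
    PowerSeries.coeff k (placementSeries Q ∅) = (placements S n k).ncard := by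
  rw [← coe_filter_packings_eq_placements hk hQ, Set.ncard_coe_finset, placementSeries,
    packingSeries, map_sum]
  simp only [PowerSeries.coeff_X_pow]
  rw [← Finset.sum_filter, Finset.sum_const, nsmul_eq_mul, mul_one]

theorem placements_finite (hconn : ∀ f ∈ S, f.Connected) (n k : ℕ) [NeZero n] :
    (placements S n k).Finite := by
  have hQ := (placedFigures_finite (K := k) hconn n).coe_toFinset
  rw [← coe_filter_packings_eq_placements le_rfl hQ]
  exact Finset.finite_toSet _

theorem placements_zero (hedge : ∀ f ∈ S, 0 < f.numEdges) (n : ℕ) :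
    placements S n 0 = {∅} := by
  ext c
  rw [Set.mem_singleton_iff]
  constructor
  · rintro ⟨h1, -, h3⟩
    refine Finset.eq_empty_of_forall_notMem fun p hp => ?_
    exact (hedge _ (h1 p hp).1).ne' (Finset.sum_eq_zero_iff.1 h3 p hp)
  · rintro rfl
    simp [placements]

end Torus

theorem mainTheorem2 (d : ℕ) (S : Set (Figure d))
    (hconn : ∀ f ∈ S, f.Connected) (hedge : ∀ f ∈ S, 0 < f.numEdges) :
    ∃ P : ℕ → ℚ[X], IsBinomialType P ∧
      ∀ k : ℕ, ∃ n₀ : ℕ, ∀ n : ℕ, n₀ ≤ n →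
        (placements S n k).Finite ∧
          ((placements S n k).ncard : ℚ) = (P k).eval ((n : ℚ) ^ d) := by
  have key : ∃ P : ℕ → ℚ[X], IsBinomialType P ∧ ∀ k : ℕ, ∀ᶠ n : ℕ in Filter.atTop,
      PowerSeries.coeff k (PowerSeries.mk fun k => ((placements S n k).ncard : ℚ)) =
        (P k).eval ((n : ℚ) ^ d) := by
    refine exists_isBinomialType_of_eventually_euler
      (F := fun n => PowerSeries.mk fun k => ((placements S n k).ncard : ℚ))
      (a := fun n => (n : ℚ) ^ d) ?_ ?_ ?_
    · refine Filter.Eventually.of_forall fun n => ?_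
      rw [← PowerSeries.coeff_zero_eq_constantCoeff_apply, PowerSeries.coeff_mk,
        placements_zero hedge, Set.ncard_singleton, Nat.cast_one]
    · filter_upwards [Filter.eventually_gt_atTop 0] with n hpos
      positivity
    · intro K
      obtain ⟨L, hL⟩ := exists_euler_placementSeries (K := K) hconn hedge K
      refine ⟨L, ?_⟩
      filter_upwards [hL, Filter.eventually_gt_atTop 0] with n hn hpos
      have : NeZero n := ⟨hpos.ne'⟩
      have hQ := (placedFigures_finite (K := K) hconn n).coe_toFinset
      set Q := (placedFigures_finite (K := K) hconn n).toFinset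
      -- Divisibility by `X ^ K` only sees coefficients below `K`, where the series with cutoff `K`
      -- agrees with the full counting series.
      have hcoeff : ∀ j ≤ K, PowerSeries.coeff j (placementSeries Q ∅) =
          PowerSeries.coeff j (PowerSeries.mk fun k => ((placements S n k).ncard : ℚ)) :=
        fun j hj => by rw [coeff_placementSeries hj hQ, PowerSeries.coeff_mk]
      have h1 := PowerSeries.X_pow_dvd_iff.1 (hn Q hQ)
      rw [PowerSeries.X_pow_dvd_iff]
      intro j hj
      rw [← h1 j hj, map_sub, map_sub, coeff_X_mul_derivative, coeff_X_mul_derivative,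
        hcoeff j hj.le, PowerSeries.coeff_mul, PowerSeries.coeff_mul]
      congr 1
      refine Finset.sum_congr rfl fun p hp => ?_
      rw [hcoeff p.2 ((Finset.HasAntidiagonal.mem_antidiagonal.1 hp ▸ Nat.le_add_left _ _ :
        p.2 ≤ j).trans hj.le)]
  obtain ⟨P, hP, h⟩ := key
  refine ⟨P, hP, fun k => ?_⟩
  rw [← Filter.eventually_atTop]
  filter_upwards [h k, Filter.eventually_gt_atTop 0] with n hn hpos
  have : NeZero n := ⟨hpos.ne'⟩
  exact ⟨placements_finite hconn n k, by rw [← hn, PowerSeries.coeff_mk]⟩
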